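/- Let $r$ be a positive integer and $\mathbb A=\{1,\dots,r\}$. A biword is a word $\alpha=\binom{x_1\cdots x_n}{a_1\cdots a_n}=\binom{x_1}{a_1}\cdots\binom{x_n}{a_n}$ ($n\ge 0$) in the biletters $\binom xa$ with $x,a\in\mathbb A$; biwords are multiplied by concatenation. Let $\mathcal A$ be the algebra of all formal (possibly infinite) sums $\sum_\alpha c(\alpha)\,\alpha$ over biwords with $c(\alpha)\in\mathbb Z$, with the product extending concatenation and with unit $1$ the empty biword. A biword is irreducible if it has no double descent, i.e. no two consecutive biletters $\binom xa\binom yb$ with $x>y$ and $a\ge b$. The reduction $E\mapsto[E]$ on $\mathcal A$ is defined as follows. If $\alpha$ is an irreducible biword, $[\alpha]=\alpha$. Otherwise write $\alpha=\beta\binom{xy}{ab}\gamma$ with $\binom{xy}{ab}$ the first (leftmost) double descent of $\alpha$, and put, recursively, $$[\alpha]=\Bigl[\beta\tbinom{yx}{ba}\gamma\Bigr]+\Bigl[\beta\tbinom{yx}{ab}\gamma\Bigr]-\Bigl[\beta\tbinom{xy}{ba}\gamma\Bigr]\quad\text{if } a>b,\qquad [\alpha]=\Bigl[\beta\tbinom{yx}{aa}\gamma\Bigr]\quad\text{if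 } a=b.$$ The recursion terminates and preserves length. The reduction is extended by linearity to finite sums, and to all of $\mathcal A$ by $[E]=\sum_{n\ge0}[E^{(n)}]$, where $E^{(n)}$ is the (finite) sum of the terms of $E$ of length $n$. Let $$\mathrm{Ferm}(1)=\sum_{J\subseteq\mathbb A}(-1)^{|J|}\sum_{\sigma\in\mathfrak S_J}(-1)^{\mathrm{inv}\,\sigma}\binom{\sigma(i_1)\,\sigma(i_2)\cdots\sigma(i_l)}{i_1\; i_2\cdots i_l},\qquad \mathrm{Bos}(1)=\sum_w\binom{\overline w}{w},$$ where $J=\{i_1<\cdots<i_l\}$, $\mathfrak S_J$ is the group of permutations of $J$, $\mathrm{inv}\,\sigma$ is the number of inversions of $\sigma$, $w$ runs over all words on $\mathbb A$ and $\overline w$ is the nondecreasing rearrangement of $w$. Then $$[\mathrm{Ferm}(1)\times\mathrm{Bos}(1)]=1.$$ -/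

import Mathlib

open scoped BigOperators

noncomputable section

namespace RightQuantum

/-- A biletter: a pair `(x, a)`, written vertically with `x` on top and `a` below, of letters of the
alphabet `{1, …, r}`, modelled by the linearly ordered set `Fin r`. -/
abbrev Biletter (r : ℕ) : Type := Fin r × Fin r

/-- A biword is a finite word of biletters; the product of biwords is concatenation. -/
abbrev Biword (r : ℕ) : Type := List (Biletter r)

/-- The top word of a biword. -/
def top {r : ℕ} (α : Biword r) : List (Fin r) := α.map Prod.fst

/-- The bottom word of a biword. -/
def bottom {r : ℕ} (α : Biword r) : List (Fin r) := α.map Prod.snd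

/-- The number of inversions of a finite sequence `f` (a word, or a permutation of an ordered set):
the number of pairs `i < j` with `f i > f j`. -/
def inv {ι κ : Type*} [Fintype ι] [LinearOrder ι] [LinearOrder κ] (f : ι → κ) : ℕ :=
  (Finset.univ.filter fun p : ι × ι => p.1 < p.2 ∧ f p.2 < f p.1).card

/-! ### The large algebra of formal sums of biwords -/

/-- An expression: a formal, possibly infinite, sum `∑ c(α) α` over all biwords `α`, given by its
coefficients `c(α)` in `R`. -/
def Expression (R : Type*) (r : ℕ) : Type _ := Biword r → R

namespace Expression

variable {R : Type*} [CommRing R] {r : ℕ}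

instance : AddCommGroup (Expression R r) := inferInstanceAs (AddCommGroup (Biword r → R))

instance : Module R (Expression R r) := inferInstanceAs (Module R (Biword r → R))

/-- The expression consisting of a single biword, with coefficient `1`. -/
def ofBiword (α : Biword r) : Expression R r := fun β => if β = α then 1 else 0

/-- The unit: the empty biword. -/
instance : One (Expression R r) := ⟨ofBiword []⟩

/-- The product extending concatenation of biwords: the coefficient of `α` in `E * F` is the sum of
`E β * F γ` over all factorizations `α = β γ`. -/
instance : Mul (Expression R r) :=
  ⟨fun E F α => ∑ i ∈ Finset.range (α.length + 1), E (α.take i) * F (α.drop i)⟩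

end Expression

/-! ### The Fermion and the Boson -/

/-- The biword with bottom word `i₁ i₂ ⋯ iₗ` and top word `σ(i₁) σ(i₂) ⋯ σ(iₗ)`, where
`J = {i₁ < i₂ < ⋯ < iₗ}` and `σ` is a permutation of `J`. -/
def permBiword {r : ℕ} (J : Finset (Fin r)) (σ : Equiv.Perm J) : Biword r :=
  ((Finset.univ : Finset J).sort (· ≤ ·)).map fun i => ((σ i : Fin r), (i : Fin r))

/-- The `q`-Fermion, for an invertible element `q`. -/
def Ferm {R : Type*} [CommRing R] (r : ℕ) (q : Rˣ) : Expression R r :=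
  ∑ J : Finset (Fin r), (-1 : R) ^ J.card •
    ∑ σ : Equiv.Perm J,
      (((-q) ^ (-(inv σ : ℤ)) : Rˣ) : R) • Expression.ofBiword (permBiword J σ)

/-- The `q`-Boson: the formal sum over all words `w` of `q ^ inv w` times the biword with bottom
word `w` and top word the nondecreasing rearrangement of `w`. Distinct `w` give distinct biwords. -/
def Bos {R : Type*} [CommRing R] (r : ℕ) (q : Rˣ) : Expression R r := fun α =>
  if top α = (bottom α).mergeSort (· ≤ ·) then (q : R) ^ inv (bottom α).get else 0

/-! ### The reduction -/

/-- Two consecutive biletters `(x, a)`, `(y, b)` form a double descent if `x > y` and `a ≥ b`. -/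
def IsDoubleDescent {r : ℕ} (p p' : Biletter r) : Prop := p'.1 < p.1 ∧ p'.2 ≤ p.2

instance {r : ℕ} (p p' : Biletter r) : Decidable (IsDoubleDescent p p') :=
  inferInstanceAs (Decidable (_ ∧ _))

/-- The factorization `α = β p p' γ` at the first (leftmost) double descent `p p'` of `α`;
`none` if `α` is irreducible, that is, has no double descent. -/
def firstDoubleDescent {r : ℕ} : Biword r → Option (Biword r × Biletter r × Biletter r × Biword r)
  | [] => none
  | [_] => none
  | p :: p' :: γ =>
    if IsDoubleDescent p p' then some ([], p, p', γ)
    else (firstDoubleDescent (p' :: γ)).map fun t => (p :: t.1, t.2)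

theorem firstDoubleDescent_eq_some {r : ℕ} : ∀ (α β γ : Biword r) (p p' : Biletter r),
    firstDoubleDescent α = some (β, p, p', γ) →
      α = β ++ p :: p' :: γ ∧ IsDoubleDescent p p'
  | [], β, γ, p, p', h => by simp [firstDoubleDescent] at h
  | [_], β, γ, p, p', h => by simp [firstDoubleDescent] at h
  | s :: s' :: δ, β, γ, p, p', h => by
    unfold firstDoubleDescent at h
    split_ifs at h with hd
    · simp only [Option.some.injEq, Prod.mk.injEq] at h
      obtain ⟨rfl, rfl, rfl, rfl⟩ := h
      exact ⟨rfl, hd⟩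
    · rw [Option.map_eq_some_iff] at h
      obtain ⟨⟨β', s1, s2, γ'⟩, h1, h2⟩ := h
      simp only [Prod.mk.injEq] at h2
      obtain ⟨rfl, rfl, rfl, rfl⟩ := h2
      have ih := firstDoubleDescent_eq_some (s' :: δ) β' γ' s1 s2 h1
      exact ⟨by rw [ih.1]; rfl, ih.2⟩

/-- A weight that decreases under every reduction step; it is used for termination only. -/
def weight {r : ℕ} : Biword r → ℕ
  | [] => 0
  | p :: α => (p.1.val + p.2.val) * (α.length + 1) + weight α

theorem weight_lt {r : ℕ} (β γ : Biword r) (p p' s s' : Biletter r)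
    (h : s.1.val + s.2.val + (s'.1.val + s'.2.val) = p.1.val + p.2.val + (p'.1.val + p'.2.val))
    (hlt : s.1.val + s.2.val < p.1.val + p.2.val) :
    weight (β ++ s :: s' :: γ) < weight (β ++ p :: p' :: γ) := by
  induction β with
  | nil =>
    simp only [List.nil_append, weight, List.length_cons]
    nlinarith
  | cons t β ih =>
    simp only [List.cons_append, weight, List.length_append, List.length_cons]
    omega

/-- The reduction `[α]` of a biword: an irreducible biword is its own reduction; otherwise, if
`α = β (x,a) (y,b) γ` with the first double descent exhibited, that factor is replaced by
`(y,a)(x,a)` if `a = b`, and by `(y,b)(x,a) + (y,a)(x,b) - (x,b)(y,a)` if `a > b`, and the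
resulting biwords are reduced again. -/
def reduceBiword {r : ℕ} (α : Biword r) : Biword r →₀ ℤ :=
  match _h : firstDoubleDescent α with
  | none => Finsupp.single α 1
  | some (β, (x, a), (y, b), γ) =>
    if _hab : a = b then
      reduceBiword (β ++ (y, a) :: (x, a) :: γ)
    else
      reduceBiword (β ++ (y, b) :: (x, a) :: γ) + reduceBiword (β ++ (y, a) :: (x, b) :: γ)
        - reduceBiword (β ++ (x, b) :: (y, a) :: γ)
termination_by weight α
decreasing_by
  all_goals
    obtain ⟨rfl, hd⟩ := firstDoubleDescent_eq_some _ _ _ _ _ _h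
    simp only [IsDoubleDescent, Fin.lt_def, Fin.le_def] at hd
    try simp only [Fin.ext_iff] at _hab
    apply weight_lt <;> simp only <;> omega

/-- The reduction of finite expressions, extending the reduction of biwords by linearity. -/
def reduceFinite {r : ℕ} : (Biword r →₀ ℤ) →ₗ[ℤ] (Biword r →₀ ℤ) :=
  Finsupp.linearCombination ℤ reduceBiword

/-- The homogeneous component of degree `n` of an expression, consisting of its terms of length
`n`; it is a finite expression because the alphabet is finite. -/
def component {r : ℕ} (E : Expression ℤ r) (n : ℕ) : Biword r →₀ ℤ :=
  ∑ w : Fin n → Biletter r, Finsupp.single (List.ofFn w) (E (List.ofFn w))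

/-- Reduction preserves the length. -/
theorem length_eq_of_reduceBiword_ne_zero {r : ℕ} (α δ : Biword r)
    (h : reduceBiword α δ ≠ 0) : δ.length = α.length := by
  induction α using reduceBiword.induct with
  | case1 α hα =>
    rw [reduceBiword] at h
    split at h
    · by_contra hne
      apply h
      rw [Finsupp.single_apply, if_neg]
      rintro rfl
      exact hne rfl
    · simp_all
  | case2 α β x y b γ hα ih =>
    have hs := (firstDoubleDescent_eq_some _ _ _ _ _ hα).1
    rw [reduceBiword] at h
    split at h
    · simp_all
    · rename_i heq
      rw [hα] at heq
      simp only [Option.some.injEq, Prod.mk.injEq] at heq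
      obtain ⟨rfl, ⟨rfl, rfl⟩, ⟨rfl, rfl⟩, rfl⟩ := heq
      rw [dif_pos rfl] at h
      rw [ih h, hs]
      simp
  | case3 α β x a y b γ hα hab ih1 ih2 ih3 =>
    have hs := (firstDoubleDescent_eq_some _ _ _ _ _ hα).1
    rw [reduceBiword] at h
    split at h
    · simp_all
    · rename_i heq
      rw [hα] at heq
      simp only [Option.some.injEq, Prod.mk.injEq] at heq
      obtain ⟨rfl, ⟨rfl, rfl⟩, ⟨rfl, rfl⟩, rfl⟩ := heq
      rw [dif_neg hab, Finsupp.sub_apply, Finsupp.add_apply] at h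
      have hl : ∀ s s' : Biletter r, (β ++ s :: s' :: γ).length = α.length := by
        intro s s'; rw [hs]; simp
      rw [hl] at ih1 ih2 ih3
      by_contra hne
      have h1 := not_imp_comm.1 ih1 hne
      have h2 := not_imp_comm.1 ih2 hne
      have h3 := not_imp_comm.1 ih3 hne
      exact h (by rw [h1, h2, h3]; rfl)

/-- The reduction `[E] = ∑ₙ [E⁽ⁿ⁾]` of an arbitrary expression. As reduction preserves the length,
only `[E⁽ⁿ⁾]` with `n` the length of `δ` contributes to the coefficient of `δ`. -/
def reduction {r : ℕ} (E : Expression ℤ r) : Expression ℤ r := fun δ =>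
  reduceFinite (component E δ.length) δ

end RightQuantum

end

/-!
The reduction replaces double descents by means of the relations
`(x,a)(y,b) + (x,b)(y,a) = (y,b)(x,a) + (y,a)(x,b)` of the right quantum algebra. The argument has
two halves.

**Confluence.** For every biword `δ`, the function `α ↦ [α](δ)` satisfies these relations at every
position of a word, not only at its first double descent (`swapRel_reduceBiword`). This is the
diamond lemma, by induction on the weight. The only ambiguity that is not between disjoint factors
is `(x,a)(y,b)(z,c)` with `x > y > z` and `a ≥ b ≥ c`. It resolves because the antisymmetrization of
the three top letters together with the symmetrization of the three bottom letters can be written as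
a signed sum of relations on the first two places, and also on the last two places.

**A Koszul-type cancellation of traces.** Fix `n > 0` and let `f u v` be the coefficient of `δ` in
the reduction of the biword with top word `u` and bottom word `v`. Thanks to the relations, sums over
increasing tuples (the Fermion) and over words paired with their sorted rearrangement (the Boson) can
be replaced by sums over all tuples and all permutations (`factorial_mul_sum_strictMono`,
`factorial_mul_sum_sort`). Up to the sign `(-1) ^ k`, the component of `Ferm * Bos` with `k` letters
from `Ferm` then contributes `T k / (k! (n - k)!)`, where `T k` is the trace `hookTrace f k 1` of the
operator that antisymmetrizes the first `k` places and symmetrizes the others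
(`factorial_mul_sum_Ferm_Bos`). Let `O k` be the trace `overlapTrace f k` in which the antisymmetrizer
of the first `k + 1` places and the symmetrizer of the last `n - k` places share one place. Coset
decompositions of the two groups give `n T k = k O (k - 1) + (n - k) O k` (`hookTrace_recursion`), so
that the alternating sum of the `T k / (k! (n - k)!)` telescopes to zero
(`alternating_sum_hookTrace`).
-/

noncomputable section

namespace RightQuantum

/-! ### The reduction respects the relations at every position -/

section

variable {r : ℕ}

/-- Relative to a given double descent `p q`, the first double descent either is `p q`, overlaps it
in `p`, or lies entirely to its left. -/
theorem firstDoubleDescent_cases {p q : Biletter r} (hpq : IsDoubleDescent p q) (γ : Biword r) :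
    ∀ β : Biword r,
      firstDoubleDescent (β ++ p :: q :: γ) = some (β, p, q, γ) ∨
      (∃ β₁ s, β = β₁ ++ [s] ∧ IsDoubleDescent s p ∧
        firstDoubleDescent (β ++ p :: q :: γ) = some (β₁, s, p, q :: γ)) ∨
      ∃ β₁ s s' β₂, β = β₁ ++ s :: s' :: β₂ ∧ IsDoubleDescent s s' ∧
        firstDoubleDescent (β ++ p :: q :: γ) = some (β₁, s, s', β₂ ++ p :: q :: γ)
  | [] => by
    left
    simp [firstDoubleDescent, hpq]
  | [t] => by
    by_cases h : IsDoubleDescent t p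
    · right; left
      exact ⟨[], t, rfl, h, by simp [firstDoubleDescent, h]⟩
    · left
      simp [firstDoubleDescent, h, hpq]
  | t :: t' :: β => by
    by_cases h : IsDoubleDescent t t'
    · right; right
      exact ⟨[], t, t', β, rfl, h, by simp [firstDoubleDescent, h]⟩
    · have key : firstDoubleDescent ((t :: t' :: β) ++ p :: q :: γ) =
          (firstDoubleDescent ((t' :: β) ++ p :: q :: γ)).map fun z => (t :: z.1, z.2) := by
        simp [firstDoubleDescent, h]
      rw [key]
      rcases firstDoubleDescent_cases hpq γ (t' :: β) with h1 | ⟨β₁, s, e, hd, h1⟩ |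
        ⟨β₁, s, s', β₂, e, hd, h1⟩
      · left; rw [h1]; rfl
      · right; left
        exact ⟨t :: β₁, s, by rw [e]; rfl, hd, by rw [h1]; rfl⟩
      · right; right
        exact ⟨t :: β₁, s, s', β₂, by rw [e]; rfl, hd, by rw [h1]; rfl⟩

theorem reduceBiword_of_firstDoubleDescent {α β γ : Biword r} {x y a b : Fin r}
    (h : firstDoubleDescent α = some (β, (x, a), (y, b), γ)) :
    reduceBiword α =
      if a = b then reduceBiword (β ++ (y, a) :: (x, a) :: γ)
      else reduceBiword (β ++ (y, b) :: (x, a) :: γ) + reduceBiword (β ++ (y, a) :: (x, b) :: γ)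
        - reduceBiword (β ++ (x, b) :: (y, a) :: γ) := by
  rw [reduceBiword.eq_def α]
  split
  · simp_all
  · rename_i heq
    rw [h] at heq
    simp only [Option.some.injEq, Prod.mk.injEq] at heq
    obtain ⟨rfl, ⟨rfl, rfl⟩, ⟨rfl, rfl⟩, rfl⟩ := heq
    rfl

theorem reduceBiword_step {α β γ : Biword r} {x y a b : Fin r}
    (h : firstDoubleDescent α = some (β, (x, a), (y, b), γ)) :
    reduceBiword (β ++ (x, a) :: (y, b) :: γ) + reduceBiword (β ++ (x, b) :: (y, a) :: γ) =
      reduceBiword (β ++ (y, b) :: (x, a) :: γ) + reduceBiword (β ++ (y, a) :: (x, b) :: γ) := by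
  have hα := reduceBiword_of_firstDoubleDescent h
  rw [(firstDoubleDescent_eq_some _ _ _ _ _ h).1] at hα
  split_ifs at hα with hab
  · subst hab
    rw [hα]
  · rw [hα]
    abel

/-- The analogue of `weight_lt` for the rearrangement of three consecutive biletters. -/
theorem weight_lt_triple (β γ : Biword r) (p₁ p₂ p₃ q₁ q₂ q₃ : Biletter r)
    (h : p₁.1.val + p₁.2.val + (p₂.1.val + p₂.2.val) + (p₃.1.val + p₃.2.val) =
      q₁.1.val + q₁.2.val + (q₂.1.val + q₂.2.val) + (q₃.1.val + q₃.2.val))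
    (hlt : 2 * (p₁.1.val + p₁.2.val) + (p₂.1.val + p₂.2.val) <
      2 * (q₁.1.val + q₁.2.val) + (q₂.1.val + q₂.2.val)) :
    weight (β ++ p₁ :: p₂ :: p₃ :: γ) < weight (β ++ q₁ :: q₂ :: q₃ :: γ) := by
  induction β with
  | nil =>
    simp only [List.nil_append, weight, List.length_cons]
    nlinarith
  | cons t β ih =>
    simp only [List.cons_append, weight, List.length_append, List.length_cons]
    omega

/-- The relation of the right quantum algebra with context `β`, `γ`, for a function `F` on biwords:
`F` takes equal values on the two sides of
`β((x,a)(y,b) + (x,b)(y,a))γ = β((y,b)(x,a) + (y,a)(x,b))γ`. For `a = b` it is twice the commutation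
relation, which is equivalent to that relation because `ℤ` has no torsion. -/
def SwapRel (F : Biword r → ℤ) (β : Biword r) (x y a b : Fin r) (γ : Biword r) : Prop :=
  F (β ++ (x, a) :: (y, b) :: γ) + F (β ++ (x, b) :: (y, a) :: γ) =
    F (β ++ (y, b) :: (x, a) :: γ) + F (β ++ (y, a) :: (x, b) :: γ)

/-- The case of the diamond lemma where the first double descent is disjoint from the one
considered. -/
theorem swapRel_of_disjoint (F : Biword r → ℤ) (β₁ β₂ γ : Biword r) {x y a b x' y' a' b' : Fin r}
    (hxy : y < x) (hab : b ≤ a) (hxy' : y' < x') (hab' : b' ≤ a')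
    (ih : ∀ β x₁ y₁ a₁ b₁ γ₁, y₁ < x₁ → b₁ ≤ a₁ → weight (β ++ (x₁, a₁) :: (y₁, b₁) :: γ₁) <
      weight (β₁ ++ (x', a') :: (y', b') :: (β₂ ++ (x, a) :: (y, b) :: γ)) →
      SwapRel F β x₁ y₁ a₁ b₁ γ₁)
    (h0 : SwapRel F β₁ x' y' a' b' (β₂ ++ (x, a) :: (y, b) :: γ)) :
    SwapRel F (β₁ ++ (x', a') :: (y', b') :: β₂) x y a b γ := by
  have left : ∀ p q : Biletter r,
      p.1.val + p.2.val + (q.1.val + q.2.val) = x.val + a.val + (y.val + b.val) →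
      p.1.val + p.2.val < x.val + a.val →
      SwapRel F β₁ x' y' a' b' (β₂ ++ p :: q :: γ) := by
    intro p q h1 h2
    refine ih _ _ _ _ _ _ hxy' hab' ?_
    have := weight_lt (β₁ ++ (x', a') :: (y', b') :: β₂) γ (x, a) (y, b) p q h1 h2
    simpa using this
  have right : ∀ s s' : Biletter r,
      s.1.val + s.2.val + (s'.1.val + s'.2.val) = x'.val + a'.val + (y'.val + b'.val) →
      s.1.val + s.2.val < x'.val + a'.val →
      SwapRel F (β₁ ++ s :: s' :: β₂) x y a b γ := by
    intro p q h1 h2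
    refine ih _ _ _ _ _ _ hxy hab ?_
    have := weight_lt β₁ (β₂ ++ (x, a) :: (y, b) :: γ) (x', a') (y', b') p q h1 h2
    simpa using this
  simp only [Fin.lt_def, Fin.le_def] at hxy hab hxy' hab'
  have l2 := left (y, b) (x, a) (by simp only; omega) (by simp only; omega)
  have l3 := left (y, a) (x, b) (by simp only; omega) (by simp only; omega)
  have r2 := right (y', b') (x', a') (by simp only; omega) (by simp only; omega)
  have r3 := right (y', a') (x', b') (by simp only; omega) (by simp only; omega)
  have l1 : SwapRel F β₁ x' y' a' b' (β₂ ++ (x, b) :: (y, a) :: γ) := by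
    rcases eq_or_ne a b with rfl | hne
    · exact h0
    · have := Fin.val_ne_of_ne hne
      exact left (x, b) (y, a) (by simp only; omega) (by simp only; omega)
  have r1 : SwapRel F (β₁ ++ (x', b') :: (y', a') :: β₂) x y a b γ ∨ a' = b' := by
    rcases eq_or_ne a' b' with rfl | hne
    · exact .inr rfl
    · have := Fin.val_ne_of_ne hne
      exact .inl (right (x', b') (y', a') (by simp only; omega) (by simp only; omega))
  simp only [SwapRel, List.append_assoc, List.cons_append] at *
  -- Apply the first relation to the four terms of the second, and conversely; for `a' = b'` this
  -- gives twice the claim.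
  rcases r1 with r1 | rfl <;> linarith

/-- The case of the diamond lemma where two double descents share a biletter. The signed sum of the
nine relations on the last two places equals that of the nine relations on the first two places;
all of them but the one to be proved have smaller weight, start at the first double descent, or
coincide with the one to be proved when bottom letters are equal. -/
theorem swapRel_of_overlap (F : Biword r → ℤ) (β γ : Biword r) {x y z a b c : Fin r}
    (hxy : y < x) (hyz : z < y) (hab : b ≤ a) (hbc : c ≤ b)
    (ih : ∀ β' x₁ y₁ a₁ b₁ γ₁, y₁ < x₁ → b₁ ≤ a₁ → weight (β' ++ (x₁, a₁) :: (y₁, b₁) :: γ₁) <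
      weight (β ++ (x, a) :: (y, b) :: (z, c) :: γ) → SwapRel F β' x₁ y₁ a₁ b₁ γ₁)
    (h0 : SwapRel F β x y a b ((z, c) :: γ)) :
    SwapRel F (β ++ [(x, a)]) y z b c γ := by
  have first : ∀ x₁ y₁ z₁ a₁ b₁ c₁ : Fin r, y₁ < x₁ → b₁ ≤ a₁ →
      x₁.val + a₁.val + (y₁.val + b₁.val) + (z₁.val + c₁.val) =
        x.val + a.val + (y.val + b.val) + (z.val + c.val) →
      2 * (x₁.val + a₁.val) + (y₁.val + b₁.val) < 2 * (x.val + a.val) + (y.val + b.val) →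
      SwapRel F β x₁ y₁ a₁ b₁ ((z₁, c₁) :: γ) := fun x₁ y₁ z₁ a₁ b₁ c₁ h1 h2 h3 h4 =>
    ih _ _ _ _ _ _ h1 h2 (weight_lt_triple β γ (x₁, a₁) (y₁, b₁) (z₁, c₁) _ _ _ h3 h4)
  have second : ∀ x₁ y₁ z₁ a₁ b₁ c₁ : Fin r, z₁ < y₁ → c₁ ≤ b₁ →
      x₁.val + a₁.val + (y₁.val + b₁.val) + (z₁.val + c₁.val) =
        x.val + a.val + (y.val + b.val) + (z.val + c.val) →
      2 * (x₁.val + a₁.val) + (y₁.val + b₁.val) < 2 * (x.val + a.val) + (y.val + b.val) →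
      SwapRel F (β ++ [(x₁, a₁)]) y₁ z₁ b₁ c₁ γ := fun x₁ y₁ z₁ a₁ b₁ c₁ h1 h2 h3 h4 =>
    ih _ _ _ _ _ _ h1 h2 (by
      have := weight_lt_triple β γ (x₁, a₁) (y₁, b₁) (z₁, c₁) (x, a) (y, b) (z, c) h3 h4
      simpa using this)
  have hac := hbc.trans hab
  have hxz := hyz.trans hxy
  have vxy := Fin.lt_def.1 hxy
  have vyz := Fin.lt_def.1 hyz
  have vab := Fin.le_def.1 hab
  have vbc := Fin.le_def.1 hbc
  have f1 : SwapRel F β x y a c ((z, b) :: γ) := by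
    rcases eq_or_ne b c with rfl | hne
    · exact h0
    · have := Fin.val_ne_of_ne hne
      exact first _ _ _ _ _ _ hxy hac (by omega) (by omega)
  have f2 : SwapRel F β x y b c ((z, a) :: γ) := by
    rcases eq_or_ne a b with rfl | hne
    · exact f1
    · have := Fin.val_ne_of_ne hne
      exact first _ _ _ _ _ _ hxy hbc (by omega) (by omega)
  have f3 := first x z y a b c hxz hab (by omega) (by omega)
  have f4 := first x z y a c b hxz hac (by omega) (by omega)
  have f5 := first x z y b c a hxz hbc (by omega) (by omega)
  have f6 := first y z x a b c hyz hab (by omega) (by omega)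
  have f7 := first y z x a c b hyz hac (by omega) (by omega)
  have f8 := first y z x b c a hyz hbc (by omega) (by omega)
  have s3 := second y x z a b c hxz hbc (by omega) (by omega)
  have s4 := second y x z b a c hxz hac (by omega) (by omega)
  have s5 := second y x z c a b hxz hab (by omega) (by omega)
  have s6 := second z x y a b c hxy hbc (by omega) (by omega)
  have s7 := second z x y b a c hxy hac (by omega) (by omega)
  have s8 := second z x y c a b hxy hab (by omega) (by omega)
  have s1 : SwapRel F (β ++ [(x, b)]) y z a c γ ∨ a = b := by
    rcases eq_or_ne a b with rfl | hne
    · exact .inr rfl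
    · have := Fin.val_ne_of_ne hne
      exact .inl (second _ _ _ _ _ _ hyz hac (by omega) (by omega))
  have s2 : SwapRel F (β ++ [(x, c)]) y z a b γ ∨ a = b ∧ b = c := by
    by_cases h : a = b ∧ b = c
    · exact .inr h
    · rw [Fin.ext_iff, Fin.ext_iff] at h
      exact .inl (second _ _ _ _ _ _ hyz hab (by omega) (by omega))
  clear ih first second hxy hyz hab hbc hac hxz vxy vyz vab vbc
  simp only [SwapRel, List.append_assoc, List.cons_append, List.nil_append] at *
  -- When `a = b` or `a = b = c`, the signed sum shows that two or three times the relation holds.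
  rcases s2 with s2 | ⟨rfl, rfl⟩
  · rcases s1 with s1 | rfl <;> linarith
  · linarith

theorem swapRel_reduceBiword_of_doubleDescent (δ : Biword r) (N : ℕ) :
    ∀ β x y a b γ, y < x → b ≤ a → weight (β ++ (x, a) :: (y, b) :: γ) < N →
      SwapRel (fun α : Biword r => reduceBiword α δ) β x y a b γ := by
  induction N with
  | zero => intros; omega
  | succ N ihN =>
    intro β x y a b γ hxy hab hw
    have step : ∀ {α β γ : Biword r} {x y a b : Fin r},
        firstDoubleDescent α = some (β, (x, a), (y, b), γ) →
        SwapRel (fun α : Biword r => reduceBiword α δ) β x y a b γ := fun h => by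
      have := congrArg (· δ) (reduceBiword_step h)
      simpa only [SwapRel, Finsupp.add_apply] using this
    rcases firstDoubleDescent_cases (p := (x, a)) (q := (y, b)) ⟨hxy, hab⟩ γ β with
      h | ⟨β₁, ⟨x', a'⟩, rfl, hd, h⟩ | ⟨β₁, ⟨x', a'⟩, ⟨y', b'⟩, β₂, rfl, hd, h⟩
    · exact step h
    · refine swapRel_of_overlap _ β₁ γ hd.1 hxy hd.2 hab ?_ (step h)
      intro β x₁ y₁ a₁ b₁ γ₁ h1 h2 h3
      refine ihN _ _ _ _ _ _ h1 h2 (h3.trans_le ?_)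
      simpa [Nat.lt_succ_iff] using hw
    · refine swapRel_of_disjoint _ β₁ β₂ γ hxy hab hd.1 hd.2 ?_ (step h)
      intro β x₁ y₁ a₁ b₁ γ₁ h1 h2 h3
      refine ihN _ _ _ _ _ _ h1 h2 (h3.trans_le ?_)
      simpa [Nat.lt_succ_iff] using hw

/-- The coefficients of the reduction satisfy the relations of the right quantum algebra in every
context: the reduction factors through that algebra. -/
theorem swapRel_reduceBiword (δ β : Biword r) (x y a b : Fin r) (γ : Biword r) :
    SwapRel (fun α : Biword r => reduceBiword α δ) β x y a b γ := by
  have key : ∀ x y a b, y < x → b ≤ a →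
      SwapRel (fun α : Biword r => reduceBiword α δ) β x y a b γ := fun x y a b h1 h2 =>
    swapRel_reduceBiword_of_doubleDescent δ _ β x y a b γ h1 h2 (Nat.lt_succ_self _)
  have key' : ∀ x y a b, y < x → SwapRel (fun α : Biword r => reduceBiword α δ) β x y a b γ := by
    intro x y a b h
    rcases le_total b a with h' | h'
    · exact key x y a b h h'
    · have := key x y b a h h'
      simp only [SwapRel] at this ⊢
      linarith
  rcases lt_trichotomy x y with h | rfl | h
  · have := key' y x a b h
    simp only [SwapRel] at this ⊢
    linarith
  · simp only [SwapRel]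
    exact add_comm _ _
  · exact key' x y a b h

end

/-! ### Symmetrization over groups of permutations -/

section

open Equiv Finset

variable {n : ℕ} {κ : Type*}

/-- The permutations of `Fin n` that fix every point outside `S`. -/
def permsOn (S : Finset (Fin n)) : Finset (Perm (Fin n)) :=
  univ.filter fun σ => ∀ i, i ∉ S → σ i = i

theorem mem_permsOn {S : Finset (Fin n)} {σ : Perm (Fin n)} :
    σ ∈ permsOn S ↔ ∀ i, i ∉ S → σ i = i := by
  simp [permsOn]

theorem mul_mem_permsOn {S : Finset (Fin n)} {σ τ : Perm (Fin n)} (hσ : σ ∈ permsOn S)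
    (hτ : τ ∈ permsOn S) : σ * τ ∈ permsOn S := by
  rw [mem_permsOn] at *
  intro i hi
  rw [Perm.mul_apply, hτ i hi, hσ i hi]

theorem inv_mem_permsOn {S : Finset (Fin n)} {σ : Perm (Fin n)} (hσ : σ ∈ permsOn S) :
    σ⁻¹ ∈ permsOn S := by
  rw [mem_permsOn] at *
  intro i hi
  rw [Perm.inv_eq_iff_eq, hσ i hi]

theorem swap_mem_permsOn {S : Finset (Fin n)} {i j : Fin n} (hi : i ∈ S) (hj : j ∈ S) :
    swap i j ∈ permsOn S := by
  rw [mem_permsOn]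
  intro l hl
  exact swap_apply_of_ne_of_ne (by rintro rfl; exact hl hi) (by rintro rfl; exact hl hj)

theorem commute_of_mem_permsOn {S S' : Finset (Fin n)} (h : Disjoint S S') {σ τ : Perm (Fin n)}
    (hσ : σ ∈ permsOn S) (hτ : τ ∈ permsOn S') : σ * τ = τ * σ := by
  rw [mem_permsOn] at *
  refine (Perm.Disjoint.commute fun i => ?_)
  by_cases hi : i ∈ S
  · exact .inr (hτ i (Finset.disjoint_left.1 h hi))
  · exact .inl (hσ i hi)

theorem sum_permsOn_mul_left {S : Finset (Fin n)} {π : Perm (Fin n)} (hπ : π ∈ permsOn S)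
    (F : Perm (Fin n) → ℚ) : ∑ σ ∈ permsOn S, F (π * σ) = ∑ σ ∈ permsOn S, F σ :=
  Finset.sum_bij' (fun σ _ => π * σ) (fun σ _ => π⁻¹ * σ)
    (fun _ h => mul_mem_permsOn hπ h) (fun _ h => mul_mem_permsOn (inv_mem_permsOn hπ) h)
    (by simp) (by simp) (by simp)

theorem sum_permsOn_mul_right {S : Finset (Fin n)} {π : Perm (Fin n)} (hπ : π ∈ permsOn S)
    (F : Perm (Fin n) → ℚ) : ∑ σ ∈ permsOn S, F (σ * π) = ∑ σ ∈ permsOn S, F σ :=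
  Finset.sum_bij' (fun σ _ => σ * π) (fun σ _ => σ * π⁻¹)
    (fun _ h => mul_mem_permsOn h hπ) (fun _ h => mul_mem_permsOn h (inv_mem_permsOn hπ))
    (by simp) (by simp) (by simp)

/-- The transpositions `(i j)` with `i ∈ S ∪ {j}`, including the identity `(j j)`, represent the left
cosets of the permutations of `S` in those of `S ∪ {j}`. -/
theorem sum_permsOn_insert {S : Finset (Fin n)} {j : Fin n} (hj : j ∉ S)
    (F : Perm (Fin n) → ℚ) :
    ∑ σ ∈ permsOn (insert j S), F σ =
      ∑ i ∈ insert j S, ∑ σ ∈ permsOn S, F (swap i j * σ) := by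
  rw [← Finset.sum_product']
  refine Finset.sum_bij' (fun σ _ => (σ j, swap (σ j) j * σ)) (fun p _ => swap p.1 j * p.2)
    ?_ ?_ ?_ ?_ ?_
  · intro σ hσ
    rw [mem_permsOn] at hσ
    rw [Finset.mem_product, mem_permsOn]
    refine ⟨?_, fun i hi => ?_⟩
    · by_contra h
      have h1 := hσ _ h
      have h2 : σ j = j := σ.injective h1
      rw [h2] at h
      exact h (mem_insert_self _ _)
    · rw [Perm.mul_apply]
      by_cases hij : i = j
      · rw [hij, swap_apply_left]
      · have h1 : σ i = i := hσ i (by simp [hij, hi])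
        rw [h1]
        refine swap_apply_of_ne_of_ne ?_ hij
        intro h2
        exact hij (σ.injective (h1.trans h2))
  · rintro ⟨i, σ⟩ h
    rw [Finset.mem_product] at h
    refine mul_mem_permsOn (swap_mem_permsOn h.1 (mem_insert_self _ _)) ?_
    have := mem_permsOn.1 h.2
    exact mem_permsOn.2 fun l hl => this l fun h => hl (mem_insert_of_mem h)
  · intro σ _
    simp
  · rintro ⟨i, σ⟩ h
    rw [Finset.mem_product] at h
    have : σ j = j := mem_permsOn.1 h.2 j hj
    simp [this]
  · intro σ _
    simp

/-- The exchange relations twisted by a character `χ` of the symmetric group. For `χ = sign` they say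
that antisymmetrizing adjacent places of the first argument and symmetrizing them in the second one
gives zero; for `χ = 1` the roles are reversed. -/
def ExchangeRel (χ : Perm (Fin n) →* ℤˣ) (g : (Fin n → κ) → (Fin n → κ) → ℚ) : Prop :=
  ∀ i j : Fin n, i.val + 1 = j.val → ∀ u v : Fin n → κ,
    g u v + (χ (swap i j) : ℤ) * g (u ∘ swap i j) v =
      (χ (swap i j) : ℤ) * g u (v ∘ swap i j) + g (u ∘ swap i j) (v ∘ swap i j)

/-- The `χ`-twisted symmetrization of `g` in the places in `S` of its first argument. -/
def twist (χ : Perm (Fin n) →* ℤˣ) (S : Finset (Fin n)) (g : (Fin n → κ) → (Fin n → κ) → ℚ)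
    (u v : Fin n → κ) : ℚ :=
  ∑ σ ∈ permsOn S, (χ σ : ℤ) * g (u ∘ σ) v

theorem units_cast_mul_self (ε : ℤˣ) : ((ε : ℤ) : ℚ) * ((ε : ℤ) : ℚ) = 1 := by
  rw [← Int.cast_mul, ← Units.val_mul, Int.units_mul_self]; simp

theorem twist_comp_left (χ : Perm (Fin n) →* ℤˣ) {S : Finset (Fin n)}
    (g : (Fin n → κ) → (Fin n → κ) → ℚ) {π : Perm (Fin n)} (hπ : π ∈ permsOn S)
    (u v : Fin n → κ) : twist χ S g (u ∘ π) v = (χ π : ℤ) * twist χ S g u v := by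
  unfold twist
  rw [← sum_permsOn_mul_left hπ (fun σ => ((χ σ : ℤ) : ℚ) * g (u ∘ σ) v), Finset.mul_sum]
  refine Finset.sum_congr rfl fun σ _ => ?_
  have := units_cast_mul_self (χ π)
  rw [map_mul, Units.val_mul, Int.cast_mul, Perm.coe_mul, Function.comp_assoc, ← mul_assoc,
    ← mul_assoc, this, one_mul]

/-- By the exchange relations, twisted symmetrization in the first argument entails the same symmetry
in the second argument. -/
theorem twist_comp_adjacent (χ : Perm (Fin n) →* ℤˣ) {S : Finset (Fin n)}
    {g : (Fin n → κ) → (Fin n → κ) → ℚ} (hg : ExchangeRel χ g) {i j : Fin n} (hi : i ∈ S)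
    (hj : j ∈ S) (hij : i.val + 1 = j.val) (u v : Fin n → κ) :
    twist χ S g u (v ∘ swap i j) = (χ (swap i j) : ℤ) * twist χ S g u v := by
  have hs := swap_mem_permsOn hi hj
  have hε := units_cast_mul_self (χ (swap i j))
  have h1 : ∀ w, twist χ S g u w =
      ∑ σ ∈ permsOn S, (χ (swap i j) : ℤ) * ((χ σ : ℤ) * g (u ∘ σ ∘ swap i j) w) := by
    intro w
    unfold twist
    rw [← sum_permsOn_mul_right hs (fun σ => ((χ σ : ℤ) : ℚ) * g (u ∘ σ) w)]
    refine Finset.sum_congr rfl fun σ _ => ?_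
    rw [map_mul, Units.val_mul, Int.cast_mul, Perm.coe_mul]
    ring
  -- One copy of each side is reindexed by `σ ↦ σ * swap i j`, so that the exchange relation applies
  -- to each summand.
  have h2 : twist χ S g u v + twist χ S g u v =
      (χ (swap i j) : ℤ) * twist χ S g u (v ∘ swap i j) +
        (χ (swap i j) : ℤ) * twist χ S g u (v ∘ swap i j) := by
    conv_lhs => arg 2; rw [h1]
    conv_rhs => arg 2; rw [h1]
    unfold twist
    rw [Finset.mul_sum, Finset.mul_sum, ← Finset.sum_add_distrib, ← Finset.sum_add_distrib]
    refine Finset.sum_congr rfl fun σ _ => ?_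
    have h3 := hg i j hij (u ∘ σ) v
    rw [Function.comp_assoc] at h3
    linear_combination ((χ σ : ℤ) : ℚ) * h3 -
      ((χ σ : ℤ) : ℚ) * g (u ∘ σ ∘ swap i j) (v ∘ swap i j) * hε
  have h4 : twist χ S g u v = (χ (swap i j) : ℤ) * twist χ S g u (v ∘ swap i j) := by linarith
  rw [h4, ← mul_assoc, hε, one_mul]

theorem twist_comp_swap (χ : Perm (Fin n) →* ℤˣ) {S : Finset (Fin n)}
    (hS : ∀ i j l : Fin n, i ∈ S → j ∈ S → i ≤ l → l ≤ j → l ∈ S)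
    {g : (Fin n → κ) → (Fin n → κ) → ℚ} (hg : ExchangeRel χ g) {i j : Fin n} (hi : i ∈ S)
    (hj : j ∈ S) (u v : Fin n → κ) :
    twist χ S g u (v ∘ swap i j) = (χ (swap i j) : ℤ) * twist χ S g u v := by
  -- A transposition inside the interval is a conjugate of a shorter one by an adjacent one.
  have main : ∀ d : ℕ, ∀ i j : Fin n, i ∈ S → j ∈ S → i.val + d = j.val → ∀ v : Fin n → κ,
      twist χ S g u (v ∘ swap i j) = (χ (swap i j) : ℤ) * twist χ S g u v := by
    intro d
    induction d with
    | zero =>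
      intro i j _ _ hij v
      obtain rfl : i = j := Fin.ext (by omega)
      rw [swap_self, ← Perm.one_def, map_one]
      simp
    | succ d ih =>
      intro i j hi hj hij v
      rcases Nat.eq_zero_or_pos d with rfl | hd
      · exact twist_comp_adjacent χ hg hi hj hij u v
      · let l : Fin n := ⟨i.val + d, by omega⟩
        have hl : l ∈ S := hS i j l hi hj (Fin.le_def.2 (by simp [l]))
          (Fin.le_def.2 (by simp [l]; omega))
        have hil : i ≠ l := Fin.ne_of_val_ne (by simp [l]; omega)
        have hij' : i ≠ j := Fin.ne_of_val_ne (by omega)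
        have e : swap i j = swap l j * swap i l * swap l j := by
          rw [swap_comm i j, swap_comm i l, swap_comm l j]
          have := swap_mul_swap_mul_swap (x := i) (y := l) (z := j) hil hij'
          rw [swap_comm i l, swap_comm l j] at this
          exact this.symm
        have hlj := twist_comp_adjacent χ hg hl hj (by simp [l]; omega) u
        have h2 := ih i l hi hl (by simp [l])
        rw [e, Perm.coe_mul, Perm.coe_mul, ← Function.comp_assoc, ← Function.comp_assoc, hlj, h2,
          hlj, map_mul, map_mul]
        push_cast
        ring
  rcases le_total i j with h | h
  · exact main (j.val - i.val) i j hi hj (by have := Fin.le_def.1 h; omega) v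
  · rw [swap_comm]
    exact main (i.val - j.val) j i hj hi (by have := Fin.le_def.1 h; omega) v

end

/-! ### Traces of hook symmetrizers -/

section

open Equiv Finset

variable {n : ℕ} {κ : Type*}

/-- The initial interval `{0, …, k - 1}` of `Fin n`. -/
def lower (n k : ℕ) : Finset (Fin n) := univ.filter fun i => i.val < k

/-- The final interval `{k, …, n - 1}` of `Fin n`. -/
def upper (n k : ℕ) : Finset (Fin n) := univ.filter fun i => k ≤ i.val

theorem mem_lower {k : ℕ} {i : Fin n} : i ∈ lower n k ↔ i.val < k := by simp [lower]

theorem mem_upper {k : ℕ} {i : Fin n} : i ∈ upper n k ↔ k ≤ i.val := by simp [upper]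

theorem disjoint_lower_upper (k : ℕ) : Disjoint (lower n k) (upper n k) :=
  Finset.disjoint_left.2 fun i h1 h2 => by
    rw [mem_lower] at h1; rw [mem_upper] at h2; omega

theorem lower_succ {k : ℕ} (hk : k < n) : lower n (k + 1) = insert ⟨k, hk⟩ (lower n k) := by
  ext i
  rw [mem_insert, mem_lower, mem_lower, Fin.ext_iff]
  simp only
  omega

theorem upper_eq_insert {k : ℕ} (hk : k < n) : upper n k = insert ⟨k, hk⟩ (upper n (k + 1)) := by
  ext i
  rw [mem_insert, mem_upper, mem_upper, Fin.ext_iff]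
  simp only
  omega

theorem card_lower {k : ℕ} (hk : k ≤ n) : (lower n k).card = k := by
  induction k with
  | zero => simp [lower]
  | succ k ih =>
    rw [lower_succ hk, card_insert_of_notMem (by simp [mem_lower]), ih (by omega)]

theorem card_upper {k : ℕ} (hk : k ≤ n) : (upper n k).card = n - k := by
  have : upper n k = (lower n k)ᶜ := by
    ext i
    rw [mem_compl, mem_lower, mem_upper, not_lt]
  rw [this, card_compl, card_lower hk, Fintype.card_fin]

/-- The function `f` antisymmetrized in the first `k` places of its first argument and symmetrized in
the remaining places of its second argument. -/
def hook (f : (Fin n → κ) → (Fin n → κ) → ℚ) (k : ℕ) (u v : Fin n → κ) : ℚ :=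
  ∑ σ ∈ permsOn (lower n k), ∑ τ ∈ permsOn (upper n k), (Perm.sign σ : ℤ) * f (u ∘ σ) (v ∘ τ)

theorem hook_eq_sum_twist_sign (f : (Fin n → κ) → (Fin n → κ) → ℚ) (k : ℕ) (u v : Fin n → κ) :
    hook f k u v =
      ∑ τ ∈ permsOn (upper n k), twist Perm.sign (lower n k) f u (v ∘ τ) := by
  unfold hook twist
  rw [Finset.sum_comm]

theorem hook_eq_sum_twist_one (f : (Fin n → κ) → (Fin n → κ) → ℚ) (k : ℕ) (u v : Fin n → κ) :
    hook f k u v = ∑ σ ∈ permsOn (lower n k),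
      (Perm.sign σ : ℤ) * twist 1 (upper n k) (fun v u => f u v) v (u ∘ σ) := by
  unfold hook twist
  refine Finset.sum_congr rfl fun σ _ => ?_
  rw [Finset.mul_sum]
  simp

/-- The relations of the right quantum algebra, for a function of the top and the bottom word: they
are imposed at each pair of adjacent places. -/
def AdjacentRel (f : (Fin n → κ) → (Fin n → κ) → ℚ) : Prop :=
  ∀ i j : Fin n, i.val + 1 = j.val → ∀ u v : Fin n → κ,
    f u v + f u (v ∘ swap i j) = f (u ∘ swap i j) v + f (u ∘ swap i j) (v ∘ swap i j)

theorem AdjacentRel.exchangeRel_sign {f : (Fin n → κ) → (Fin n → κ) → ℚ} (hf : AdjacentRel f) :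
    ExchangeRel Perm.sign f := by
  intro i j hij u v
  rw [Perm.sign_swap (Fin.ne_of_val_ne (by omega))]
  have := hf i j hij u v
  push_cast
  linarith

theorem AdjacentRel.exchangeRel_one {f : (Fin n → κ) → (Fin n → κ) → ℚ} (hf : AdjacentRel f) :
    ExchangeRel 1 fun v u => f u v := by
  intro i j hij u v
  have := hf i j hij v u
  simp only [MonoidHom.one_apply, Units.val_one, Int.cast_one, one_mul]
  linarith

variable {f : (Fin n → κ) → (Fin n → κ) → ℚ} {k : ℕ}

theorem hook_lower_left {π : Perm (Fin n)} (hπ : π ∈ permsOn (lower n k)) (u v : Fin n → κ) :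
    hook f k (u ∘ π) v = (Perm.sign π : ℤ) * hook f k u v := by
  simp only [hook_eq_sum_twist_sign, twist_comp_left _ f hπ, Finset.mul_sum]

theorem hook_upper_right {π : Perm (Fin n)} (hπ : π ∈ permsOn (upper n k)) (u v : Fin n → κ) :
    hook f k u (v ∘ π) = hook f k u v := by
  simp only [hook_eq_sum_twist_one, twist_comp_left _ (fun v u => f u v) hπ]
  simp

theorem hook_lower_right (hf : AdjacentRel f) {i j : Fin n} (hi : i ∈ lower n k)
    (hj : j ∈ lower n k) (u v : Fin n → κ) :
    hook f k u (v ∘ swap i j) = (Perm.sign (swap i j) : ℤ) * hook f k u v := by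
  rw [hook_eq_sum_twist_sign, hook_eq_sum_twist_sign, Finset.mul_sum]
  refine Finset.sum_congr rfl fun τ hτ => ?_
  have h := commute_of_mem_permsOn (disjoint_lower_upper k) (swap_mem_permsOn hi hj) hτ
  rw [Function.comp_assoc, ← Perm.coe_mul, h, Perm.coe_mul, ← Function.comp_assoc]
  refine twist_comp_swap _ ?_ hf.exchangeRel_sign hi hj _ _
  intro i j l _ hj _ h
  rw [mem_lower] at *
  exact lt_of_le_of_lt h hj

theorem hook_upper_left (hf : AdjacentRel f) {i j : Fin n} (hi : i ∈ upper n k)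
    (hj : j ∈ upper n k) (u v : Fin n → κ) :
    hook f k (u ∘ swap i j) v = hook f k u v := by
  rw [hook_eq_sum_twist_one, hook_eq_sum_twist_one]
  refine Finset.sum_congr rfl fun σ hσ => ?_
  have h := commute_of_mem_permsOn (disjoint_lower_upper k) hσ (swap_mem_permsOn hi hj)
  rw [Function.comp_assoc, ← Perm.coe_mul, ← h, Perm.coe_mul, ← Function.comp_assoc,
    twist_comp_swap 1 ?_ hf.exchangeRel_one hi hj]
  · simp
  · intro i j l hi _ h _
    rw [mem_upper] at *
    exact le_trans hi h

variable [Fintype κ]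

theorem sum_comp_perm (π : Perm (Fin n)) (F : (Fin n → κ) → ℚ) :
    ∑ u, F (u ∘ π) = ∑ u, F u :=
  Equiv.sum_comp (Equiv.arrowCongr π.symm (Equiv.refl κ)) F

/-- The trace of the operator `hook f k`, composed with the permutation `π` of the places. -/
def hookTrace (f : (Fin n → κ) → (Fin n → κ) → ℚ) (k : ℕ) (π : Perm (Fin n)) : ℚ :=
  ∑ u, hook f k (u ∘ π) u

/-- The trace of `f` antisymmetrized in the first `k + 1` places and symmetrized in the last `n - k`
places, the place `k` belonging to both groups. -/
def overlapTrace (f : (Fin n → κ) → (Fin n → κ) → ℚ) (k : ℕ) : ℚ :=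
  ∑ u : Fin n → κ, ∑ σ ∈ permsOn (lower n (k + 1)), ∑ τ ∈ permsOn (upper n k),
    (Perm.sign σ : ℤ) * f (u ∘ σ) (u ∘ τ)

/-- The trace does not depend on which antisymmetrized place is exchanged with `j`: conjugate by a
transposition of the two candidates, which changes the sign twice. -/
theorem hookTrace_swap_lower (hf : AdjacentRel f) {i i' j : Fin n} (hi : i ∈ lower n k)
    (hi' : i' ∈ lower n k) (hj : j ∈ upper n k) :
    hookTrace f k (swap i j) = hookTrace f k (swap i' j) := by
  rcases eq_or_ne i i' with rfl | hne
  · rfl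
  have hij : i ≠ j := by rintro rfl; rw [mem_lower] at hi; rw [mem_upper] at hj; omega
  have hc := swap_mem_permsOn hi hi'
  have e : swap i j = swap i i' * swap i' j * swap i i' := by
    have := swap_mul_swap_mul_swap (x := j) (y := i') (z := i)
      (by rintro rfl; rw [mem_lower] at hi'; rw [mem_upper] at hj; omega) hij.symm
    rw [swap_comm i' i, swap_comm j i'] at this
    exact this.symm
  unfold hookTrace
  rw [← sum_comp_perm (swap i i') fun u => hook f k (u ∘ swap i' j) u]
  refine Finset.sum_congr rfl fun u _ => ?_
  rw [hook_lower_right hf hi hi', e, Perm.coe_mul, ← Function.comp_assoc, hook_lower_left hc,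
    Perm.coe_mul, ← Function.comp_assoc]

/-- The trace does not depend on which symmetrized place is exchanged with `i`. -/
theorem hookTrace_swap_upper (hf : AdjacentRel f) {i j j' : Fin n} (hi : i ∈ lower n k)
    (hj : j ∈ upper n k) (hj' : j' ∈ upper n k) :
    hookTrace f k (swap i j) = hookTrace f k (swap i j') := by
  rcases eq_or_ne j j' with rfl | hne
  · rfl
  have hij : i ≠ j := by rintro rfl; rw [mem_lower] at hi; rw [mem_upper] at hj; omega
  have hc := swap_mem_permsOn hj hj'
  have e : swap i j = swap j j' * swap i j' * swap j j' := by
    have := swap_mul_swap_mul_swap (x := i) (y := j') (z := j)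
      (by rintro rfl; rw [mem_lower] at hi; rw [mem_upper] at hj'; omega) hij
    rw [swap_comm j' j, swap_comm j i] at this
    exact this.symm
  unfold hookTrace
  rw [← sum_comp_perm (swap j j') fun u => hook f k (u ∘ swap i j') u]
  refine Finset.sum_congr rfl fun u _ => ?_
  rw [hook_upper_right hc, e, Perm.coe_mul, ← Function.comp_assoc, hook_upper_left hf hj hj',
    Perm.coe_mul, ← Function.comp_assoc]

theorem overlapTrace_eq_sub (hk : k < n) :
    overlapTrace f k = hookTrace f k 1 - ∑ i ∈ lower n k, hookTrace f k (swap i ⟨k, hk⟩) := by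
  have hmem : (⟨k, hk⟩ : Fin n) ∉ lower n k := by simp [mem_lower]
  have key : ∀ i ∈ lower n k, ∀ σ : Perm (Fin n),
      ((Perm.sign (swap i ⟨k, hk⟩ * σ) : ℤ) : ℚ) = -((Perm.sign σ : ℤ) : ℚ) := by
    intro i hi σ
    rw [Perm.sign_mul, Perm.sign_swap (by rintro rfl; exact hmem hi)]
    simp
  have e : ∀ u : Fin n → κ, ∑ σ ∈ permsOn (lower n (k + 1)), ∑ τ ∈ permsOn (upper n k),
      (Perm.sign σ : ℤ) * f (u ∘ σ) (u ∘ τ) =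
      hook f k u u - ∑ i ∈ lower n k, hook f k (u ∘ swap i ⟨k, hk⟩) u := by
    intro u
    rw [lower_succ hk, sum_permsOn_insert hmem, Finset.sum_insert hmem, swap_self,
      sub_eq_add_neg, ← Finset.sum_neg_distrib]
    congr 1
    refine Finset.sum_congr rfl fun i hi => ?_
    simp only [hook, ← Finset.sum_neg_distrib]
    refine Finset.sum_congr rfl fun σ _ => Finset.sum_congr rfl fun τ _ => ?_
    rw [key i hi, Perm.coe_mul, ← Function.comp_assoc, neg_mul]
  simp only [overlapTrace, hookTrace, e, Finset.sum_sub_distrib]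
  rw [Finset.sum_comm]
  rfl

theorem overlapTrace_eq_add (hk : k < n) :
    overlapTrace f k = hookTrace f (k + 1) 1 +
      ∑ j ∈ upper n (k + 1), hookTrace f (k + 1) (swap ⟨k, hk⟩ j) := by
  have hmem : (⟨k, hk⟩ : Fin n) ∉ upper n (k + 1) := by simp [mem_upper]
  have e : ∀ u : Fin n → κ, ∑ σ ∈ permsOn (lower n (k + 1)), ∑ τ ∈ permsOn (upper n k),
      (Perm.sign σ : ℤ) * f (u ∘ σ) (u ∘ τ) =
      hook f (k + 1) u u + ∑ j ∈ upper n (k + 1), hook f (k + 1) u (u ∘ swap j ⟨k, hk⟩) := by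
    intro u
    rw [Finset.sum_comm, upper_eq_insert hk, sum_permsOn_insert hmem, Finset.sum_insert hmem,
      swap_self]
    congr 1
    · rw [Finset.sum_comm]; rfl
    refine Finset.sum_congr rfl fun i hi => ?_
    rw [Finset.sum_comm]
    rfl
  simp only [overlapTrace, hookTrace, e, Finset.sum_add_distrib]
  congr 1
  rw [Finset.sum_comm]
  refine Finset.sum_congr rfl fun j _ => ?_
  rw [← sum_comp_perm (swap j ⟨k, hk⟩), swap_comm ⟨k, hk⟩ j]
  refine Finset.sum_congr rfl fun u _ => ?_
  rw [Function.comp_assoc, ← Perm.coe_mul, swap_mul_self, Perm.coe_one, Function.comp_id]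

/-- The two coset expansions of overlapping traces, `overlapTrace_eq_sub` and `overlapTrace_eq_add`,
combine so that the transposition terms cancel. At `k = 0` and `k = n` the term with a meaningless
overlapping trace has coefficient zero. -/
theorem hookTrace_recursion (hf : AdjacentRel f) (hk : k ≤ n) :
    (n : ℚ) * hookTrace f k 1 =
      (k : ℚ) * overlapTrace f (k - 1) + ((n : ℚ) - k) * overlapTrace f k := by
  -- The traces in `W` depend neither on `i` nor on `j`, so `W` can be computed from either of the
  -- two coset expansions.
  set W : ℚ := ∑ i ∈ lower n k, ∑ j ∈ upper n k, hookTrace f k (swap i j) with hW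
  have h1 : ((n : ℚ) - k) * overlapTrace f k = ((n : ℚ) - k) * hookTrace f k 1 - W := by
    rcases hk.eq_or_lt with rfl | hlt
    · have : upper k k = ∅ := by
        rw [← Finset.card_eq_zero, card_upper le_rfl, Nat.sub_self]
      simp [hW, this]
    · rw [overlapTrace_eq_sub hlt, mul_sub, hW, Finset.mul_sum]
      congr 1
      refine Finset.sum_congr rfl fun i hi => ?_
      rw [Finset.sum_congr rfl fun j hj => hookTrace_swap_upper hf hi hj
        (show (⟨k, hlt⟩ : Fin n) ∈ upper n k by simp [mem_upper]), Finset.sum_const,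
        card_upper hk, nsmul_eq_mul, Nat.cast_sub hk]
  have h2 : (k : ℚ) * overlapTrace f (k - 1) = (k : ℚ) * hookTrace f k 1 + W := by
    rcases k with _ | k
    · simp [hW, lower]
    · have hlt : k < n := hk
      rw [Nat.add_sub_cancel, overlapTrace_eq_add hlt, mul_add, hW, Finset.sum_comm,
        Finset.mul_sum]
      congr 1
      refine Finset.sum_congr rfl fun j hj => ?_
      rw [Finset.sum_congr rfl fun i hi => hookTrace_swap_lower hf hi
        (show (⟨k, hlt⟩ : Fin n) ∈ lower n (k + 1) by simp [mem_lower]) hj, Finset.sum_const,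
        card_lower hk, nsmul_eq_mul]
  rw [h1, h2]
  ring

/-- The alternating sum telescopes by `hookTrace_recursion`. -/
theorem alternating_sum_hookTrace (hf : AdjacentRel f) (hn : n ≠ 0) :
    ∑ k ∈ range (n + 1), (-1 : ℚ) ^ k *
      (hookTrace f k 1 / ((k.factorial : ℚ) * ((n - k).factorial : ℚ))) = 0 := by
  let h : ℕ → ℚ := fun k =>
    k * overlapTrace f (k - 1) / ((k.factorial : ℚ) * ((n - k).factorial : ℚ))
  have hsucc : ∀ k, k ≤ n → ((n : ℚ) - k) * overlapTrace f k /
      ((k.factorial : ℚ) * ((n - k).factorial : ℚ)) = if k < n then h (k + 1) else 0 := by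
    intro k hk
    split_ifs with hlt
    · obtain ⟨m, rfl⟩ : ∃ m, n = k + 1 + m := ⟨n - k - 1, by omega⟩
      have e1 : k + 1 + m - k = m + 1 := by omega
      have e2 : k + 1 + m - (k + 1) = m := by omega
      simp only [h, e1, e2, Nat.add_sub_cancel, Nat.factorial_succ]
      push_cast
      have h1 : ((k : ℚ) + 1) ≠ 0 := by positivity
      have h2 : ((m : ℚ) + 1) ≠ 0 := by positivity
      have h3 : (k.factorial : ℚ) ≠ 0 := by positivity
      have h4 : (m.factorial : ℚ) ≠ 0 := by positivity
      field_simp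
      ring
    · obtain rfl : k = n := by omega
      simp
  have hsplit : ∀ k, k ≤ n → (n : ℚ) * (hookTrace f k 1 /
      ((k.factorial : ℚ) * ((n - k).factorial : ℚ))) = h k + if k < n then h (k + 1) else 0 := by
    intro k hk
    rw [← hsucc k hk, ← mul_div_assoc, hookTrace_recursion hf hk, add_div]
  have tele : ∀ N, N ≤ n → ∑ k ∈ range N, (-1 : ℚ) ^ k * (n * (hookTrace f k 1 /
      ((k.factorial : ℚ) * ((n - k).factorial : ℚ)))) = -(-1 : ℚ) ^ N * h N := by
    intro N
    induction N with
    | zero => simp [h]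
    | succ N ih =>
      intro hN
      rw [Finset.sum_range_succ, ih (by omega), hsplit N (by omega), if_pos (by omega), pow_succ]
      ring
  have hn' : (n : ℚ) ≠ 0 := by exact_mod_cast hn
  refine (mul_eq_zero.1 (?_ : (n : ℚ) * _ = 0)).resolve_left hn'
  rw [Finset.mul_sum]
  simp only [mul_left_comm (n : ℚ)]
  rw [Finset.sum_range_succ, tele n le_rfl, hsplit n le_rfl, if_neg (lt_irrefl n)]
  ring

end

/-! ### From sorted tuples to all tuples -/

section

open Equiv Finset

variable {n k m : ℕ} {κ : Type*}

theorem permsOn_univ : permsOn (univ : Finset (Fin n)) = univ := by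
  simp [permsOn]

theorem twist_univ_comp_right (χ : Perm (Fin n) →* ℤˣ) {g : (Fin n → κ) → (Fin n → κ) → ℚ}
    (hg : ExchangeRel χ g) (π : Perm (Fin n)) (u v : Fin n → κ) :
    twist χ univ g u (v ∘ π) = (χ π : ℤ) * twist χ univ g u v := by
  induction π using Perm.swap_induction_on' with
  | one => simp
  | mul_swap π i j _ ih =>
    rw [Perm.coe_mul, ← Function.comp_assoc,
      twist_comp_swap χ (fun _ _ _ _ _ _ _ => mem_univ _) hg (mem_univ i) (mem_univ j), ih,
      map_mul]
    push_cast
    ring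

theorem sum_permsOn_eq {S : Finset (Fin n)} (e : Fin k ≃ {i // i ∈ S}) (G : Perm (Fin n) → ℚ) :
    ∑ σ ∈ permsOn S, G σ = ∑ π : Perm (Fin k), G (Perm.ofSubtype (e.permCongr π)) := by
  rw [Finset.sum_subtype (permsOn S) (p := fun σ => ∀ a, ¬ a ∈ S → σ a = a)
    (fun _ => mem_permsOn) G,
    ← Equiv.sum_comp (e.permCongr.trans (Perm.subtypeEquivSubtypePerm fun i => i ∈ S))]
  rfl

/-- The first `k` places of `Fin (k + m)`, numbered by `Fin k`. -/
def lowerEquiv (k m : ℕ) : Fin k ≃ {i // i ∈ lower (k + m) k} where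
  toFun i := ⟨Fin.castAdd m i, by simp [mem_lower]⟩
  invFun i := ⟨i.1.val, mem_lower.1 i.2⟩
  left_inv _ := rfl
  right_inv _ := rfl

/-- The last `m` places of `Fin (k + m)`, numbered by `Fin m`. -/
def upperEquiv (k m : ℕ) : Fin m ≃ {i // i ∈ upper (k + m) k} where
  toFun i := ⟨Fin.natAdd k i, by simp [mem_upper]⟩
  invFun i := ⟨i.1.val - k, by have := i.1.2; have := mem_upper.1 i.2; omega⟩
  left_inv i := by simp
  right_inv i := by
    have := mem_upper.1 i.2
    ext
    simp only [Fin.natAdd_mk]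
    omega

theorem append_comp_lower (u₁ : Fin k → κ) (u₂ : Fin m → κ) (π : Perm (Fin k)) :
    Fin.append u₁ u₂ ∘ Perm.ofSubtype ((lowerEquiv k m).permCongr π) =
      Fin.append (u₁ ∘ π) u₂ := by
  ext i
  induction i using Fin.addCases with
  | left i =>
    rw [Function.comp_apply, Perm.ofSubtype_apply_of_mem _
      (show Fin.castAdd m i ∈ lower (k + m) k by simp [mem_lower]), Fin.append_left]
    exact Fin.append_left _ _ _
  | right i =>
    rw [Function.comp_apply, Perm.ofSubtype_apply_of_not_mem _ (by simp [mem_lower]),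
      Fin.append_right, Fin.append_right]

theorem append_comp_upper (u₁ : Fin k → κ) (u₂ : Fin m → κ) (π : Perm (Fin m)) :
    Fin.append u₁ u₂ ∘ Perm.ofSubtype ((upperEquiv k m).permCongr π) =
      Fin.append u₁ (u₂ ∘ π) := by
  ext i
  induction i using Fin.addCases with
  | left i =>
    rw [Function.comp_apply, Perm.ofSubtype_apply_of_not_mem _ (by simp [mem_upper]),
      Fin.append_left, Fin.append_left]
  | right i =>
    have h : Fin.natAdd k i ∈ upper (k + m) k := by simp [mem_upper]
    rw [Function.comp_apply, Perm.ofSubtype_apply_of_mem _ h, Fin.append_right]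
    have : (⟨Fin.natAdd k i, h⟩ : {i // i ∈ upper (k + m) k}) = upperEquiv k m i := rfl
    rw [this, Equiv.permCongr_apply, Equiv.symm_apply_apply]
    exact Fin.append_right _ _ _

variable [Fintype κ]

theorem hookTrace_eq_sum_append (f : (Fin (k + m) → κ) → (Fin (k + m) → κ) → ℚ) :
    hookTrace f k 1 = ∑ u₁ : Fin k → κ, ∑ u₂ : Fin m → κ, ∑ σ : Perm (Fin k), ∑ τ : Perm (Fin m),
      (Perm.sign σ : ℤ) * f (Fin.append (u₁ ∘ σ) u₂) (Fin.append u₁ (u₂ ∘ τ)) := by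
  unfold hookTrace hook
  rw [← Equiv.sum_comp (Fin.appendEquiv k m), Fintype.sum_prod_type]
  refine Finset.sum_congr rfl fun u₁ _ => Finset.sum_congr rfl fun u₂ _ => ?_
  rw [sum_permsOn_eq (lowerEquiv k m)]
  refine Finset.sum_congr rfl fun σ _ => ?_
  rw [sum_permsOn_eq (upperEquiv k m)]
  refine Finset.sum_congr rfl fun τ _ => ?_
  rw [Perm.sign_ofSubtype, Perm.sign_permCongr, Perm.coe_one, Function.comp_id]
  change _ * f (Fin.append u₁ u₂ ∘ _) (Fin.append u₁ u₂ ∘ _) = _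
  rw [append_comp_lower, append_comp_upper]

/-- The Boson as a sum over all tuples and all permutations. The symmetrized function depends only on
the multiset of entries of each argument, so sorting the first one makes no difference. -/
theorem factorial_mul_sum_sort {g : (Fin n → κ) → (Fin n → κ) → ℚ} [LinearOrder κ]
    (hg : AdjacentRel g) :
    (n.factorial : ℚ) * ∑ v : Fin n → κ, g (v ∘ Tuple.sort v) v =
      ∑ v : Fin n → κ, ∑ τ : Perm (Fin n), g v (v ∘ τ) := by
  have h1 : (n.factorial : ℚ) * ∑ v : Fin n → κ, g (v ∘ Tuple.sort v) v =
      ∑ τ : Perm (Fin n), ∑ v : Fin n → κ, g (v ∘ Tuple.sort v) (v ∘ τ) := by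
    have h : ∀ τ : Perm (Fin n), ∑ v : Fin n → κ, g (v ∘ Tuple.sort v) (v ∘ τ) =
        ∑ v : Fin n → κ, g (v ∘ Tuple.sort v) v := by
      intro τ
      rw [← sum_comp_perm τ fun v => g (v ∘ Tuple.sort v) v]
      simp only [Tuple.comp_perm_comp_sort_eq_comp_sort]
    simp only [h, Finset.sum_const, card_univ, Fintype.card_perm, Fintype.card_fin, nsmul_eq_mul]
  rw [h1, Finset.sum_comm]
  refine Finset.sum_congr rfl fun v _ => ?_
  have := twist_univ_comp_right 1 hg.exchangeRel_one (Tuple.sort v) v v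
  simpa [twist, permsOn_univ] using this

/-- The Fermion as a sum over all tuples and all permutations. The diagonal of the antisymmetrized
function vanishes on tuples with a repetition and is invariant under rearrangement. -/
theorem factorial_mul_sum_strictMono {g : (Fin n → κ) → (Fin n → κ) → ℚ} [LinearOrder κ]
    (hg : AdjacentRel g) :
    (n.factorial : ℚ) * ∑ v : Fin n → κ with StrictMono v,
        ∑ σ : Perm (Fin n), (Perm.sign σ : ℤ) * g (v ∘ σ) v =
      ∑ v : Fin n → κ, ∑ σ : Perm (Fin n), (Perm.sign σ : ℤ) * g (v ∘ σ) v := by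
  let D : (Fin n → κ) → ℚ := fun v => ∑ σ : Perm (Fin n), (Perm.sign σ : ℤ) * g (v ∘ σ) v
  have hD : ∀ v, D v = twist Perm.sign univ g v v := fun v => by
    simp only [D, twist, permsOn_univ]
  have hinv : ∀ (π : Perm (Fin n)) v, D (v ∘ π) = D v := by
    intro π v
    rw [hD, hD, twist_univ_comp_right _ hg.exchangeRel_sign,
      twist_comp_left _ _ (by rw [permsOn_univ]; exact mem_univ _), ← mul_assoc,
      units_cast_mul_self, one_mul]
  have hzero : ∀ v, ¬ Function.Injective v → D v = 0 := by
    intro v hv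
    simp only [Function.Injective, not_forall] at hv
    obtain ⟨i, j, hij, hne⟩ := hv
    have h1 : v ∘ swap i j = v := by
      ext l
      rw [Function.comp_apply, swap_apply_def]
      split_ifs with h h'
      · rw [h, hij]
      · rw [h', hij]
      · rfl
    have h2 := twist_univ_comp_right _ hg.exchangeRel_sign (swap i j) v v
    rw [h1, Perm.sign_swap hne] at h2
    rw [hD]
    push_cast at h2
    linarith
  -- Exactly one rearrangement of an injective tuple is increasing.
  have hcount : ∀ v : Fin n → κ, ∑ π : Perm (Fin n), (if StrictMono (v ∘ π) then D v else 0) =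
      D v := by
    intro v
    by_cases hv : Function.Injective v
    · rw [Finset.sum_eq_single (Tuple.sort v)]
      · rw [if_pos]
        exact (Tuple.monotone_sort v).strictMono_of_injective (hv.comp (Tuple.sort v).injective)
      · intro π _ hπ
        rw [if_neg]
        intro h
        refine hπ (Equiv.ext fun i => hv ?_)
        exact congrFun (Tuple.unique_monotone h.monotone (Tuple.monotone_sort v)) i
      · simp
    · simp [hzero v hv]
  change (n.factorial : ℚ) * ∑ v : Fin n → κ with StrictMono v, D v = ∑ v, D v
  have h : ∀ π : Perm (Fin n), ∑ v : Fin n → κ, (if StrictMono (v ∘ π) then D v else 0) =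
      ∑ v : Fin n → κ with StrictMono v, D v := by
    intro π
    rw [Finset.sum_filter, ← sum_comp_perm π fun v => if StrictMono v then D v else 0]
    simp only [hinv]
  calc (n.factorial : ℚ) * ∑ v : Fin n → κ with StrictMono v, D v
      = ∑ π : Perm (Fin n), ∑ v : Fin n → κ, (if StrictMono (v ∘ π) then D v else 0) := by
        simp only [h, Finset.sum_const, card_univ, Fintype.card_perm, Fintype.card_fin,
          nsmul_eq_mul]
    _ = ∑ v, D v := by
        rw [Finset.sum_comm]
        exact Finset.sum_congr rfl fun v _ => hcount v

end

/-! ### Expansions over words -/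

section

open Equiv Finset

variable {r n k m : ℕ}

/-- The biword with top word `u` and bottom word `v`. -/
def pairWord (u v : Fin n → Fin r) : Biword r := List.ofFn fun i => (u i, v i)

theorem pairWord_append (u v : Fin k → Fin r) (u' v' : Fin m → Fin r) :
    pairWord (Fin.append u u') (Fin.append v v') = pairWord u v ++ pairWord u' v' := by
  unfold pairWord
  rw [← List.ofFn_fin_append]
  congr 1
  ext1 i
  induction i using Fin.addCases <;> simp

/-- Tuples that agree outside two adjacent places have lists with a common prefix and suffix around
these places. -/
theorem ofFn_eq_of_agree {α : Type*} {w w' : Fin n → α} {i j : Fin n} (hij : i.val + 1 = j.val)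
    (h : ∀ l, l ≠ i → l ≠ j → w' l = w l) :
    List.ofFn w' = (List.ofFn w).take i ++ w' i :: w' j :: (List.ofFn w).drop (j + 1) := by
  have hi := i.2
  have hj := j.2
  refine List.ext_getElem (by simp; omega) fun l h1 h2 => ?_
  simp only [List.length_ofFn] at h1
  rw [List.getElem_ofFn, List.getElem_append]
  simp only [List.length_take, List.length_ofFn]
  split_ifs with hl
  · rw [List.getElem_take, List.getElem_ofFn]
    exact h _ (Fin.ne_of_val_ne (by simp only; omega)) (Fin.ne_of_val_ne (by simp only; omega))
  · have hmin : min i.val n = i.val := by omega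
    simp only [hmin] at hl ⊢
    obtain ⟨d, rfl⟩ : ∃ d, l = i.val + d := ⟨l - i.val, by omega⟩
    rcases d with _ | _ | d
    · simp
    · simp only [zero_add, Nat.add_sub_cancel_left, List.getElem_cons_succ,
        List.getElem_cons_zero]
      exact congrArg w' (Fin.ext hij)
    · simp only [Nat.add_sub_cancel_left, List.getElem_cons_succ, List.getElem_drop,
        List.getElem_ofFn]
      rw [h _ (Fin.ne_of_val_ne (by simp only; omega)) (Fin.ne_of_val_ne (by simp only; omega))]
      congr 2
      omega

theorem adjacentRel_reduceBiword (δ β γ : Biword r) (n : ℕ) :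
    AdjacentRel fun u v : Fin n → Fin r => (reduceBiword (β ++ pairWord u v ++ γ) δ : ℚ) := by
  intro i j hij u v
  have hne : i ≠ j := Fin.ne_of_val_ne (by omega)
  have hw : ∀ u' v' : Fin n → Fin r, (∀ l, l ≠ i → l ≠ j → u' l = u l) →
      (∀ l, l ≠ i → l ≠ j → v' l = v l) →
      pairWord u' v' = (pairWord u v).take i ++
        (u' i, v' i) :: (u' j, v' j) :: (pairWord u v).drop (j + 1) :=
    fun u' v' hu hv => ofFn_eq_of_agree hij fun l h1 h2 => by rw [hu l h1 h2, hv l h1 h2]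
  have hswap : ∀ u : Fin n → Fin r, ∀ l, l ≠ i → l ≠ j → (u ∘ swap i j) l = u l :=
    fun u l h1 h2 => by rw [Function.comp_apply, swap_apply_of_ne_of_ne h1 h2]
  have hself : ∀ u : Fin n → Fin r, ∀ l, l ≠ i → l ≠ j → u l = u l := fun _ _ _ _ => rfl
  have key := swapRel_reduceBiword δ (β ++ (pairWord u v).take i) (u i) (u j) (v i) (v j)
    ((pairWord u v).drop (j + 1) ++ γ)
  simp only
  rw [hw (u ∘ swap i j) v (hswap u) (hself v), hw u (v ∘ swap i j) (hself u) (hswap v),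
    hw (u ∘ swap i j) (v ∘ swap i j) (hswap u) (hswap v)]
  conv_lhs => arg 1; rw [hw u v (hself u) (hself v)]
  simp only [Function.comp_apply, swap_apply_left, swap_apply_right, SwapRel, List.append_assoc,
    List.cons_append] at key ⊢
  have := congrArg (Int.cast : ℤ → ℚ) key
  push_cast at this
  linarith

theorem mul_apply_append_sum (E E' : Expression ℤ r) (F : Biword r → ℚ) (n : ℕ) :
    ∑ w : Fin n → Biletter r, ((E * E') (List.ofFn w) : ℚ) * F (List.ofFn w) =
      ∑ p ∈ antidiagonal n, ∑ w : Fin p.1 → Biletter r, ∑ w' : Fin p.2 → Biletter r,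
        (E (List.ofFn w) : ℚ) * (E' (List.ofFn w') : ℚ) * F (List.ofFn w ++ List.ofFn w') := by
  have h1 : ∀ w : Fin n → Biletter r, ((E * E') (List.ofFn w) : ℚ) * F (List.ofFn w) =
      ∑ p ∈ antidiagonal n, (E ((List.ofFn w).take p.1) : ℚ) * (E' ((List.ofFn w).drop p.1) : ℚ) *
        F (List.ofFn w) := by
    intro w
    have : (E * E') (List.ofFn w) = ∑ i ∈ range ((List.ofFn w).length + 1),
      E ((List.ofFn w).take i) * E' ((List.ofFn w).drop i) := rfl
    rw [this, List.length_ofFn, Int.cast_sum, Finset.sum_mul,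
      Finset.Nat.sum_antidiagonal_eq_sum_range_succ_mk]
    push_cast
    rfl
  simp only [h1]
  rw [Finset.sum_comm]
  refine Finset.sum_congr rfl fun p hp => ?_
  obtain ⟨k, m⟩ := p
  obtain rfl : k + m = n := mem_antidiagonal.1 hp
  rw [← Equiv.sum_comp (Fin.appendEquiv k m), Fintype.sum_prod_type]
  refine Finset.sum_congr rfl fun w _ => Finset.sum_congr rfl fun w' _ => ?_
  have : List.ofFn (Fin.appendEquiv k m (w, w')) = List.ofFn w ++ List.ofFn w' :=
    List.ofFn_fin_append w w'
  rw [this, List.take_left' (by simp), List.drop_left' (by simp)]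

theorem reduceFinite_component_apply (E : Expression ℤ r) (n : ℕ) (δ : Biword r) :
    reduceFinite (component E n) δ =
      ∑ w : Fin n → Biletter r, E (List.ofFn w) * reduceBiword (List.ofFn w) δ := by
  rw [reduceFinite, component, map_sum, Finsupp.finsetSum_apply]
  simp [Finsupp.linearCombination_single]

theorem sum_biletters (G : (Fin n → Biletter r) → ℚ) :
    ∑ w : Fin n → Biletter r, G w =
      ∑ v : Fin n → Fin r, ∑ u : Fin n → Fin r, G fun i => (u i, v i) := by
  rw [← Equiv.sum_comp (Equiv.arrowProdEquivProdArrow (Fin n) (fun _ => Fin r) fun _ => Fin r).symm,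
    Fintype.sum_prod_type_right]
  rfl

theorem mergeSort_ofFn (v : Fin n → Fin r) :
    (List.ofFn v).mergeSort (· ≤ ·) = List.ofFn (v ∘ Tuple.sort v) := by
  refine List.Perm.eq_of_pairwise' (r := (· ≤ ·)) ?_
    (Tuple.monotone_sort v).sortedLE_ofFn.pairwise
    ((List.mergeSort_perm _ _).trans (Perm.ofFn_comp_perm _ v).symm)
  have := List.pairwise_mergeSort (le := fun a b : Fin r => decide (a ≤ b))
    (fun a b c h1 h2 => by simp only [decide_eq_true_eq] at *; exact h1.trans h2)
    (fun a b => by simpa using le_total a b) (List.ofFn v)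
  simpa using this

theorem Bos_pairWord (u v : Fin n → Fin r) :
    Bos r (1 : ℤˣ) (pairWord u v) = if u = v ∘ Tuple.sort v then 1 else 0 := by
  have h1 : top (pairWord u v) = List.ofFn u := by simp [top, pairWord, Function.comp_def]
  have h2 : bottom (pairWord u v) = List.ofFn v := by simp [bottom, pairWord, Function.comp_def]
  unfold Bos
  rw [h1, h2, mergeSort_ofFn]
  simp [List.ofFn_injective.eq_iff]

/-- The sum of `F` over the terms of length `n` of the Boson. -/
theorem sum_Bos_mul (F : Biword r → ℚ) (n : ℕ) :
    ∑ w : Fin n → Biletter r, ((Bos r (1 : ℤˣ) (List.ofFn w) : ℤ) : ℚ) * F (List.ofFn w) =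
      ∑ v : Fin n → Fin r, F (pairWord (v ∘ Tuple.sort v) v) := by
  rw [sum_biletters]
  refine Finset.sum_congr rfl fun v _ => ?_
  change ∑ u : Fin n → Fin r, ((Bos r (1 : ℤˣ) (pairWord u v) : ℤ) : ℚ) * F (pairWord u v) = _
  simp [Bos_pairWord]

theorem Ferm_apply {R : Type*} [CommRing R] (q : Rˣ) (α : Biword r) :
    Ferm r q α = ∑ J : Finset (Fin r), (-1 : R) ^ J.card *
      ∑ σ : Perm J, (((-q) ^ (-(inv σ : ℤ)) : Rˣ) : R) * if α = permBiword J σ then 1 else 0 := by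
  let ev : Expression R r →+ R := Pi.evalAddMonoidHom (fun _ : Biword r => R) α
  have h1 : ∀ (c : R) (E : Expression R r), ev (c • E) = c * ev E := fun _ _ => rfl
  have h2 : ∀ β, ev (Expression.ofBiword β) = if α = β then 1 else 0 := fun _ => rfl
  change ev (Ferm r q) = _
  rw [Ferm]
  simp only [map_sum, h1, h2]

theorem Ferm_one_apply (α : Biword r) :
    Ferm r (1 : ℤˣ) α = ∑ J : Finset (Fin r), (-1 : ℤ) ^ J.card *
      ∑ σ : Perm J, (-1 : ℤ) ^ inv σ * if α = permBiword J σ then 1 else 0 := by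
  rw [Ferm_apply]
  simp

theorem inv_permCongr {J : Finset (Fin r)} (e : Fin k ≃o J) (π : Perm (Fin k)) :
    inv (e.toEquiv.permCongr π) = inv π := by
  unfold inv
  symm
  refine Finset.card_equiv (Equiv.prodCongr e.toEquiv e.toEquiv) fun p => ?_
  simp

theorem neg_one_pow_inv (π : Perm (Fin k)) : (-1 : ℤ) ^ inv π = (Perm.sign π : ℤ) := by
  have h : ∀ i : Fin k, ∏ j ∈ Ioi i, (if π i < π j then 1 else -1 : ℤˣ) =
      ∏ j, if i < j ∧ π j < π i then -1 else 1 := by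
    intro i
    rw [← Finset.filter_lt_eq_Ioi, Finset.prod_filter]
    refine Finset.prod_congr rfl fun j _ => ?_
    by_cases hij : i < j
    · have := π.injective.ne hij.ne
      rcases this.lt_or_gt with h | h
      · simp [hij, h, h.le]
      · simp [hij, h, h.le]
    · simp [hij]
  rw [Perm.sign_eq_prod_prod_Ioi, Finset.prod_congr rfl fun i _ => h i,
    ← Fintype.prod_prod_type' fun i j : Fin k => (if i < j ∧ π j < π i then -1 else 1 : ℤˣ),
    ← Finset.prod_filter, Finset.prod_const, inv]
  simp

theorem permBiword_permCongr {J : Finset (Fin r)} (hJ : J.card = k) (π : Perm (Fin k)) :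
    permBiword J ((J.orderIsoOfFin hJ).toEquiv.permCongr π) =
      pairWord (J.orderEmbOfFin hJ ∘ π) (J.orderEmbOfFin hJ) := by
  have h : (univ : Finset J).card = k := by rw [card_univ, Fintype.card_coe, hJ]
  have h1 := (univ : Finset J).listMap_orderEmbOfFin_finRange h
  rw [← Finset.orderEmbOfFin_unique h (fun _ => mem_univ _) (J.orderIsoOfFin hJ).strictMono] at h1
  rw [permBiword, ← h1, List.map_map, ← List.ofFn_eq_map, pairWord]
  congr 1
  ext1 i
  simp

theorem sum_ofFn_eq (α : Biword r) (F : Biword r → ℚ) (n : ℕ) :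
    ∑ w : Fin n → Biletter r, (if List.ofFn w = α then F (List.ofFn w) else 0) =
      if α.length = n then F α else 0 := by
  split_ifs with h
  · subst h
    rw [Finset.sum_eq_single α.get]
    · simp
    · intro w _ hw
      rw [if_neg]
      intro h
      apply hw
      apply List.ofFn_injective
      rw [h, List.ofFn_get]
    · simp
  · refine Finset.sum_eq_zero fun w _ => if_neg ?_
    rintro rfl
    exact h (by simp)

/-- The sum of `F` over the terms of length `k` of the Fermion. A subset of cardinality `k` is encoded
by its increasing enumeration `v`, and a permutation of it by a permutation of the indices. -/
theorem sum_Ferm_mul (F : Biword r → ℚ) (k : ℕ) :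
    ∑ w : Fin k → Biletter r, ((Ferm r (1 : ℤˣ) (List.ofFn w) : ℤ) : ℚ) * F (List.ofFn w) =
      (-1) ^ k * ∑ v : Fin k → Fin r with StrictMono v,
        ∑ σ : Perm (Fin k), (Perm.sign σ : ℤ) * F (pairWord (v ∘ σ) v) := by
  have h1 : ∑ w : Fin k → Biletter r, ((Ferm r (1 : ℤˣ) (List.ofFn w) : ℤ) : ℚ) * F (List.ofFn w) =
      ∑ J : Finset (Fin r), (-1 : ℚ) ^ J.card * ∑ σ : Perm J, (-1 : ℚ) ^ inv σ *
        if J.card = k then F (permBiword J σ) else 0 := by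
    have hl : ∀ (J : Finset (Fin r)) (σ : Perm J), (permBiword J σ).length = J.card := by
      intro J σ; simp [permBiword]
    simp only [Ferm_one_apply]
    push_cast
    simp only [Finset.sum_mul, Finset.mul_sum]
    rw [Finset.sum_comm]
    refine Finset.sum_congr rfl fun J _ => ?_
    rw [Finset.sum_comm]
    refine Finset.sum_congr rfl fun σ _ => ?_
    have h := sum_ofFn_eq (permBiword J σ) F k
    rw [hl] at h
    rw [← h, Finset.mul_sum, Finset.mul_sum]
    refine Finset.sum_congr rfl fun w _ => ?_
    split_ifs <;> ring
  have h2 : ∑ J : Finset (Fin r), (-1 : ℚ) ^ J.card * ∑ σ : Perm J, (-1 : ℚ) ^ inv σ *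
        (if J.card = k then F (permBiword J σ) else 0) =
      ∑ J : Finset (Fin r) with J.card = k,
        (-1 : ℚ) ^ k * ∑ σ : Perm J, (-1 : ℚ) ^ inv σ * F (permBiword J σ) := by
    rw [Finset.sum_filter]
    refine Finset.sum_congr rfl fun J _ => ?_
    split_ifs with h
    · rw [h]
    · simp
  rw [h1, h2, Finset.mul_sum]
  refine Finset.sum_bij' (fun J hJ => J.orderEmbOfFin (mem_filter.1 hJ).2)
    (fun v _ => univ.image v) ?_ ?_ ?_ ?_ ?_
  · intro J hJ
    simp [OrderEmbedding.strictMono]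
  · intro v hv
    rw [mem_filter] at hv ⊢
    refine ⟨mem_univ _, ?_⟩
    rw [card_image_of_injective _ hv.2.injective, card_univ, Fintype.card_fin]
  · intro J hJ
    simp
  · intro v hv
    rw [mem_filter] at hv
    exact (Finset.orderEmbOfFin_unique _ (fun i => mem_image_of_mem v (mem_univ i)) hv.2).symm
  · intro J hJ
    have hc := (mem_filter.1 hJ).2
    congr 1
    rw [← Equiv.sum_comp (J.orderIsoOfFin hc).toEquiv.permCongr]
    refine Finset.sum_congr rfl fun π _ => ?_
    rw [permBiword_permCongr, inv_permCongr]
    congr 1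
    exact_mod_cast congrArg (Int.cast : ℤ → ℚ) (neg_one_pow_inv π)

end

/-! ### The product of the Fermion and the Boson -/

section

open Equiv Finset

variable {r n k m : ℕ}

/-- The contribution of the terms of length `k` of the Fermion and those of length `m` of the Boson,
as a hook trace. -/
theorem factorial_mul_sum_Ferm_Bos (δ : Biword r) (k m : ℕ) :
    (k.factorial : ℚ) * (m.factorial : ℚ) *
      ∑ w : Fin k → Biletter r, ∑ w' : Fin m → Biletter r,
        ((Ferm r (1 : ℤˣ) (List.ofFn w) : ℤ) : ℚ) * ((Bos r (1 : ℤˣ) (List.ofFn w') : ℤ) : ℚ) *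
          (reduceBiword (List.ofFn w ++ List.ofFn w') δ : ℚ) =
      (-1) ^ k * hookTrace
        (fun u v : Fin (k + m) → Fin r => (reduceBiword (pairWord u v) δ : ℚ)) k 1 := by
  have hF : ∀ w' : Fin m → Biletter r,
      (k.factorial : ℚ) * ∑ w : Fin k → Biletter r, ((Ferm r (1 : ℤˣ) (List.ofFn w) : ℤ) : ℚ) *
        (reduceBiword (List.ofFn w ++ List.ofFn w') δ : ℚ) =
      (-1) ^ k * ∑ v : Fin k → Fin r, ∑ σ : Perm (Fin k),
        (Perm.sign σ : ℤ) * (reduceBiword (pairWord (v ∘ σ) v ++ List.ofFn w') δ : ℚ) := by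
    intro w'
    have h := adjacentRel_reduceBiword δ [] (List.ofFn w') k
    simp only [List.nil_append] at h
    rw [sum_Ferm_mul (fun α => (reduceBiword (α ++ List.ofFn w') δ : ℚ)),
      ← factorial_mul_sum_strictMono h]
    ring
  have hB : ∀ u v : Fin k → Fin r,
      (m.factorial : ℚ) * ∑ w' : Fin m → Biletter r, ((Bos r (1 : ℤˣ) (List.ofFn w') : ℤ) : ℚ) *
        (reduceBiword (pairWord u v ++ List.ofFn w') δ : ℚ) =
      ∑ u' : Fin m → Fin r, ∑ τ : Perm (Fin m),
        (reduceBiword (pairWord u v ++ pairWord u' (u' ∘ τ)) δ : ℚ) := by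
    intro u v
    have h := adjacentRel_reduceBiword δ (pairWord u v) [] m
    simp only [List.append_nil] at h
    rw [sum_Bos_mul (fun α => (reduceBiword (pairWord u v ++ α) δ : ℚ)),
      factorial_mul_sum_sort h]
  calc _ = (m.factorial : ℚ) * ∑ w' : Fin m → Biletter r,
        ((Bos r (1 : ℤˣ) (List.ofFn w') : ℤ) : ℚ) * ((k.factorial : ℚ) *
          ∑ w : Fin k → Biletter r, ((Ferm r (1 : ℤˣ) (List.ofFn w) : ℤ) : ℚ) *
            (reduceBiword (List.ofFn w ++ List.ofFn w') δ : ℚ)) := by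
        rw [Finset.sum_comm]
        simp only [Finset.mul_sum]
        refine Finset.sum_congr rfl fun _ _ => Finset.sum_congr rfl fun _ _ => ?_
        ring
    _ = (-1) ^ k * ∑ v : Fin k → Fin r, ∑ σ : Perm (Fin k), (Perm.sign σ : ℤ) *
        ((m.factorial : ℚ) * ∑ w' : Fin m → Biletter r,
          ((Bos r (1 : ℤˣ) (List.ofFn w') : ℤ) : ℚ) *
            (reduceBiword (pairWord (v ∘ σ) v ++ List.ofFn w') δ : ℚ)) := by
        simp only [hF, Finset.mul_sum]
        rw [Finset.sum_comm]
        refine Finset.sum_congr rfl fun _ _ => ?_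
        rw [Finset.sum_comm]
        refine Finset.sum_congr rfl fun _ _ => Finset.sum_congr rfl fun _ _ => ?_
        ring
    _ = _ := by
        simp only [hB, hookTrace_eq_sum_append, pairWord_append, Finset.mul_sum]
        refine Finset.sum_congr rfl fun _ _ => ?_
        rw [Finset.sum_comm]

theorem reduceFinite_component_Ferm_mul_Bos (δ : Biword r) (hn : n ≠ 0) :
    reduceFinite (component (Ferm r (1 : ℤˣ) * Bos r (1 : ℤˣ)) n) δ = 0 := by
  have hf := adjacentRel_reduceBiword δ [] [] n
  simp only [List.nil_append, List.append_nil] at hf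
  have key := alternating_sum_hookTrace hf hn
  rw [reduceFinite_component_apply]
  refine (Int.cast_injective (α := ℚ)) ?_
  push_cast
  rw [mul_apply_append_sum _ _ fun α => (reduceBiword α δ : ℚ), ← key,
    ← Finset.Nat.sum_antidiagonal_eq_sum_range_succ fun k m => (-1 : ℚ) ^ k *
      (hookTrace (fun u v : Fin n → Fin r => (reduceBiword (pairWord u v) δ : ℚ)) k 1 /
        ((k.factorial : ℚ) * (m.factorial : ℚ)))]
  refine Finset.sum_congr rfl fun p hp => ?_
  obtain ⟨k, m⟩ := p
  obtain rfl : k + m = n := mem_antidiagonal.1 hp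
  have h1 : (k.factorial : ℚ) ≠ 0 := by positivity
  have h2 : (m.factorial : ℚ) ≠ 0 := by positivity
  rw [← mul_div_assoc, eq_div_iff (mul_ne_zero h1 h2), ← factorial_mul_sum_Ferm_Bos, mul_comm]

theorem Ferm_mul_Bos_nil : (Ferm r (1 : ℤˣ) * Bos r (1 : ℤˣ)) [] = 1 := by
  have h1 : (Ferm r (1 : ℤˣ) * Bos r (1 : ℤˣ)) [] = Ferm r (1 : ℤˣ) [] * Bos r (1 : ℤˣ) [] := by
    change ∑ i ∈ range 1, _ = _
    rw [Finset.sum_range_one]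
    rfl
  have h2 : Bos r (1 : ℤˣ) [] = 1 := by
    simp [Bos, top, bottom]
  have h3 : Ferm r (1 : ℤˣ) [] = 1 := by
    have h := sum_Ferm_mul (r := r) (fun _ => 1) 0
    have : ∀ v : Fin 0 → Fin r, StrictMono v := fun v i => i.elim0
    simp [this] at h
    exact_mod_cast h
  rw [h1, h2, h3, one_mul]

end

end RightQuantum

end

theorem corollary5 (r : ℕ) :
    RightQuantum.reduction
      (RightQuantum.Ferm r (1 : ℤˣ) * RightQuantum.Bos r (1 : ℤˣ)) = 1 := by
  funext δ
  change RightQuantum.reduceFinite _ δ = if δ = [] then 1 else 0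
  split_ifs with h
  · subst h
    rw [RightQuantum.reduceFinite_component_apply]
    have : RightQuantum.reduceBiword ([] : RightQuantum.Biword r) = Finsupp.single [] 1 := by
      rw [RightQuantum.reduceBiword]
      rfl
    simp [this, RightQuantum.Ferm_mul_Bos_nil]
  · exact RightQuantum.reduceFinite_component_Ferm_mul_Bos δ (by simpa using h)
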